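/- Let $\mathbb{F}$ be $\mathbb{R}$ or $\mathbb{C}$, let $n, j \ge 0$, let $\mathrm{GrAff}_j(\mathbb{F}^n)$ be the Grassmannian of $j$-dimensional affine $\mathbb{F}$-flats of $\mathbb{F}^n$ with its usual topology and real manifold structure, and write $L(A) \subseteq \mathbb{F}^n$ for the linear part of a flat $A$ (so that $A = L(A) + c$ for some $c$). For a set $T$ of flats, let $L(T)$ be the smallest $\mathbb{F}$-linear subspace of $\mathbb{F}^n$ that contains $L(A)$ for all $A \in T$. In the case $\mathbb{F} = \mathbb{R}$, fix an o-minimal structure expanding the real field and let "definable" mean definable in it, with real parameters; in the case $\mathbb{F} = \mathbb{C}$, let "definable" mean definable over $\mathbb{C}$ in the language of fields, i.e. constructible. A definable set $T \subseteq \mathrm{GrAff}_j(\mathbb{F}^n)$ is called a neat family if (1) $T$ is a connected embedded real $C^1$ submanifold of $\mathrm{GrAff}_j(\mathbb{F}^n)$, and (2) $L(U) = L(T)$ for every nonempty $U \subseteq T$ that is open in $T$. Let $\Lambda \subset \mathbb{F}^n$ be a discrete subgroup whose real linear span $L = \mathbb{R}\Lambda$ is an $\mathbb{F}$-linear subspace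 of $\mathbb{F}^n$, and let $\pi : \mathbb{F}^n \to \mathbb{F}^n/\Lambda$ be the quotient map. If $T \subseteq \mathrm{GrAff}_j(\mathbb{F}^n)$ is a neat family such that $L(A) \subseteq L$ for all $A \in T$, then $\bigcup_{A \in T} \pi(A)$ is a topologically dense subset of $\bigcup_{A \in T} \pi(A + L(T))$. -/

import Mathlib

open scoped Pointwise

universe u v

noncomputable section

/-- The field structure of `ℂ`, as a first-order structure in the language of rings. With
parameters allowed, its definable sets are those definable over `ℂ` in the language of fields. -/
instance complexCompatibleRing : FirstOrder.Ring.CompatibleRing ℂ :=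
  FirstOrder.Ring.compatibleRingOfRing ℂ

/-- A first-order structure on `ℝ` is an o-minimal expansion of the ordered field `ℝ`: the order
and the graphs of addition and multiplication are definable, and each subset of `ℝ` that is
definable with parameters is a finite union of intervals (possibly unbounded, open, closed,
half-open, or reduced to a point). By completeness of `ℝ`, the intervals are exactly the
order-connected sets. -/
structure IsOMinimalExpansion (Lom : FirstOrder.Language.{u, v}) [Lom.Structure ℝ] : Prop where
  definable_lt :
    (Set.univ : Set ℝ).Definable Lom {x : Fin 2 → ℝ | x 0 < x 1}
  definable_add :
    (Set.univ : Set ℝ).Definable Lom {x : Fin 3 → ℝ | x 0 + x 1 = x 2}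
  definable_mul :
    (Set.univ : Set ℝ).Definable Lom {x : Fin 3 → ℝ | x 0 * x 1 = x 2}
  finite_union_intervals : ∀ S : Set ℝ, (Set.univ : Set ℝ).Definable₁ Lom S →
    ∃ I : Set (Set ℝ), I.Finite ∧ (∀ J ∈ I, J.OrdConnected) ∧ S = ⋃₀ I

/-- A subset `M` of a real normed space `E` is an embedded `C¹` submanifold: near each of its
points a `C¹` diffeomorphism between open subsets of `E` carries `M` to a linear subspace. -/
def IsC1Submanifold {E : Type*} [NormedAddCommGroup E] [NormedSpace ℝ E] (M : Set E) : Prop :=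
  ∀ x ∈ M, ∃ (Φ : OpenPartialHomeomorph E E) (V : Submodule ℝ E),
    x ∈ Φ.source ∧ ContDiffOn ℝ 1 Φ Φ.source ∧ ContDiffOn ℝ 1 Φ.symm Φ.target ∧
      Φ '' (M ∩ Φ.source) = (V : Set E) ∩ Φ.target

/-- `D` is a subset of `E` that is topologically dense in `E`. -/
def IsDenseSubset {Y : Type*} [TopologicalSpace Y] (D E : Set Y) : Prop :=
  D ⊆ E ∧ E ⊆ closure D

/-- The Grassmannian of affine `j`-dimensional flats of `𝔽ⁿ`. -/
structure GrAff (F : Type*) [RCLike F] (n j : ℕ) where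
  flat : AffineSubspace F (EuclideanSpace F (Fin n))
  nonempty : (flat : Set (EuclideanSpace F (Fin n))).Nonempty
  finrank_direction : Module.finrank F flat.direction = j

namespace GrAff

variable {F : Type*} [RCLike F] {n j : ℕ}

/-- The linear part `L(A)` of a flat `A`. -/
def lin (A : GrAff F n j) : Submodule F (EuclideanSpace F (Fin n)) := A.flat.direction

/-- The point of the flat `A` that is closest to the origin. -/
def foot (A : GrAff F n j) : EuclideanSpace F (Fin n) :=
  haveI : Nonempty A.flat := A.nonempty.to_subtype
  (EuclideanGeometry.orthogonalProjection A.flat 0 : EuclideanSpace F (Fin n))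

/-- The standard embedding of the affine Grassmannian as a (real) submanifold of a Euclidean
space: a flat is recorded by the orthogonal projection onto its linear part together with its
point closest to the origin. -/
def embed (A : GrAff F n j) :
    (EuclideanSpace F (Fin n) →L[F] EuclideanSpace F (Fin n)) × EuclideanSpace F (Fin n) :=
  (A.lin.starProjection, A.foot)

/-- The usual topology of the affine Grassmannian. -/
instance : TopologicalSpace (GrAff F n j) := TopologicalSpace.induced embed inferInstance

/-- `L(T)`: the smallest `𝔽`-linear subspace that contains `L(A)` for all `A ∈ T`. -/
def linSpan (T : Set (GrAff F n j)) : Submodule F (EuclideanSpace F (Fin n)) :=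
  ⨆ A ∈ T, A.lin

/-- The set of all `(j+1)`-tuples of points of `𝔽ⁿ` whose affine span is a member of `T`
(such tuples are affinely independent, since the members of `T` have dimension `j`). -/
def frames (T : Set (GrAff F n j)) : Set (Fin (j + 1) × Fin n → F) :=
  {x | ∃ A ∈ T, A.flat = affineSpan F
    (Set.range fun i : Fin (j + 1) => WithLp.toLp 2 fun k : Fin n => x (i, k))}

/-- A family of `j`-dimensional flats is definable (with parameters) in a first-order structure
on `𝔽` if the set of all affine frames of its members is. -/
def IsDefinable (Lang : FirstOrder.Language.{u, v}) [Lang.Structure F]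
    (T : Set (GrAff F n j)) : Prop :=
  (Set.univ : Set F).Definable Lang (frames T)

/-- Neat families of flats: definable families that are connected `ℝ`-submanifolds of the affine
Grassmannian (the empty family is not excluded) and satisfy `L(U) = L(T)` for each nonempty
subset `U` that is open in `T`. -/
structure IsNeat (Lang : FirstOrder.Language.{u, v}) [Lang.Structure F]
    (T : Set (GrAff F n j)) : Prop where
  definable : IsDefinable Lang T
  connected : IsPreconnected T
  submanifold : IsC1Submanifold (embed '' T)
  linSpan_eq : ∀ U : Set (GrAff F n j), IsOpen U → (T ∩ U).Nonempty →
    linSpan (T ∩ U) = linSpan T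

end GrAff

end

/-! For a real subspace V of ℝΛ, the closure of V + Λ contains a subspace H that contains V and is
spanned by finitely many elements of Λ. Since Λ is countable, only countably many such H occur. If H
does not contain L(T), neatness makes {B ∈ T | L(B) ⊄ H} open and dense in T, and T is a Baire
space, being locally closed in a finite-dimensional space. So the flats B of T that avoid all these
H at once are dense; for them the closure of L(B) + Λ must contain L(T), hence π(B) is dense in π(B
+ L(T)). A point of A + L(T) is approximated by points of B + L(T) with such B near A.

The carrying lemmas are `exists_finset_span_subset_closure` and
`GrAff.exists_mem_nhds_not_lin_subset`. -/

section ClosedSubgroups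

variable {E : Type*} [NormedAddCommGroup E] [NormedSpace ℝ E]

/-! ### Closed subgroups and their rational subspaces -/

/-- Integer multiples of a vector in the real span of a subgroup return arbitrarily close to
the subgroup. -/
theorem exists_nsmul_sub_norm_lt [FiniteDimensional ℝ E] (Λ : AddSubgroup E) {v : E}
    (hv : v ∈ Submodule.span ℝ (Λ : Set E)) {ε : ℝ} (hε : 0 < ε) :
    ∃ m : ℕ, 0 < m ∧ ∃ l ∈ Λ, ‖(m : ℝ) • v - l‖ < ε := by
  have hproper : ProperSpace E := FiniteDimensional.proper_real E
  obtain ⟨c, hc, rfl⟩ := (Submodule.mem_span_set).1 hv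
  -- Dirichlet's argument: rounding coefficients down splits m • v into `q m` in Λ and a bounded
  -- remainder `r m`; by compactness two remainders are within ε.
  set r : ℕ → E := fun m => c.sum fun x a => Int.fract ((m : ℝ) * a) • x with hr
  set q : ℕ → E := fun m => c.sum fun x a => (⌊(m : ℝ) * a⌋ : ℝ) • x with hq
  have hqΛ (m : ℕ) : q m ∈ Λ := by
    refine sum_mem fun x hx => ?_
    simp only [Int.cast_smul_eq_zsmul]
    exact Λ.zsmul_mem (hc hx) _
  have hdecomp (m : ℕ) : (m : ℝ) • (c.sum fun x a => a • x) = q m + r m := by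
    simp only [hq, hr, Finsupp.sum, Finset.smul_sum, ← Finset.sum_add_distrib, ← add_smul,
      Int.floor_add_fract, smul_smul]
  have hbound (m : ℕ) : r m ∈ Metric.closedBall (0 : E) (∑ x ∈ c.support, ‖x‖) := by
    rw [mem_closedBall_zero_iff]
    refine (norm_sum_le _ _).trans (Finset.sum_le_sum fun x _ => ?_)
    rw [norm_smul, Real.norm_eq_abs, abs_of_nonneg (Int.fract_nonneg _)]
    exact mul_le_of_le_one_left (norm_nonneg _) (Int.fract_lt_one _).le
  obtain ⟨a, -, φ, hφ, ha⟩ := (isCompact_closedBall (0 : E) _).tendsto_subseq hbound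
  obtain ⟨N, hN⟩ := Metric.cauchySeq_iff'.1 ha.cauchySeq ε hε
  have hlt : φ N < φ (N + 1) := hφ N.lt_succ_self
  refine ⟨φ (N + 1) - φ N, Nat.sub_pos_of_lt hlt, q (φ (N + 1)) - q (φ N),
    Λ.sub_mem (hqΛ _) (hqΛ _), ?_⟩
  have h := hN (N + 1) N.le_succ
  rw [dist_eq_norm] at h
  rw [Nat.cast_sub hlt.le, sub_smul, hdecomp, hdecomp]
  simpa [Function.comp_def, add_sub_add_comm] using h

/-- The largest linear subspace contained in an additive subgroup. -/
def AddSubgroup.linealitySpace (G : AddSubgroup E) : Submodule ℝ E where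
  carrier := {v | ∀ t : ℝ, t • v ∈ G}
  add_mem' hv hw t := by simpa [smul_add] using G.add_mem (hv t) (hw t)
  zero_mem' t := by simp
  smul_mem' c v hv t := by simpa [smul_smul] using hv (t * c)

theorem AddSubgroup.mem_of_mem_linealitySpace {G : AddSubgroup E} {v : E}
    (hv : v ∈ G.linealitySpace) : v ∈ G := by simpa using hv 1

/-- If elements of a closed subgroup tend to zero and their directions converge, then the
limiting line lies in the subgroup. -/
theorem AddSubgroup.mem_linealitySpace_of_tendsto {G : AddSubgroup E}
    (hG : IsClosed (G : Set E)) {g : ℕ → E} (hgG : ∀ k, g k ∈ G)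
    (hg : Filter.Tendsto g Filter.atTop (nhds 0)) {u : E}
    (hu : Filter.Tendsto (fun k => ‖g k‖⁻¹ • g k) Filter.atTop (nhds u)) :
    u ∈ G.linealitySpace := by
  intro t
  -- Rounding t / ‖g k‖ down to an integer moves the multiple of `g k` by at most ‖g k‖, which tends
  -- to 0.
  have hfr : Filter.Tendsto (fun k => Int.fract (t * ‖g k‖⁻¹) • g k) Filter.atTop (nhds 0) := by
    refine squeeze_zero_norm (fun k => ?_) (tendsto_norm_zero.comp hg)
    rw [norm_smul, Real.norm_eq_abs, abs_of_nonneg (Int.fract_nonneg _)]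
    exact mul_le_of_le_one_left (norm_nonneg _) (Int.fract_lt_one _).le
  have hlim := (hu.const_smul t).sub hfr
  rw [sub_zero] at hlim
  refine hG.mem_of_tendsto hlim (Filter.Eventually.of_forall fun k => ?_)
  rw [smul_smul, ← sub_smul, Int.self_sub_fract, Int.cast_smul_eq_zsmul]
  exact G.zsmul_mem (hgG k) _

/-- Near the origin a closed subgroup coincides with a linear subspace. -/
theorem AddSubgroup.exists_ball_subset_linealitySpace [FiniteDimensional ℝ E]
    {G : AddSubgroup E}
    (hG : IsClosed (G : Set E)) :
    ∃ δ > 0, ∀ g ∈ G, ‖g‖ < δ → g ∈ G.linealitySpace := by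
  have hproper : ProperSpace E := FiniteDimensional.proper_real E
  by_contra! h
  -- Projecting to a complement W of the lineality space keeps elements in G, so small
  -- counterexamples yield a unit limit direction in W that also lies in the lineality space.
  obtain ⟨W, hW⟩ := G.linealitySpace.exists_isCompl
  let P : E →ₗ[ℝ] E := W.subtype ∘ₗ W.projectionOnto G.linealitySpace hW.symm
  have hPsub (x : E) : x - P x ∈ G.linealitySpace := by
    rw [← Submodule.projectionOnto_apply_eq_zero_iff hW.symm, map_sub]
    simp only [P, LinearMap.comp_apply, Submodule.subtype_apply,
      Submodule.projectionOnto_apply_left, sub_self]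
  have hPW (x : E) : P x ∈ W := Submodule.coe_mem _
  choose g hgG hgδ hgL using fun k : ℕ => h (1 / ((k : ℝ) + 1)) Nat.one_div_pos_of_nat
  have hg : Filter.Tendsto g Filter.atTop (nhds 0) :=
    squeeze_zero_norm (fun k => (hgδ k).le) tendsto_one_div_add_atTop_nhds_zero_nat
  have hPg : Filter.Tendsto (fun k => P (g k)) Filter.atTop (nhds 0) := by
    simpa [Function.comp_def] using (P.continuous_of_finiteDimensional.tendsto 0).comp hg
  have hPgG (k : ℕ) : P (g k) ∈ G := by
    simpa using G.sub_mem (hgG k) (mem_of_mem_linealitySpace (hPsub (g k)))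
  have hPg0 (k : ℕ) : P (g k) ≠ 0 := fun h0 => hgL k (by simpa [h0] using hPsub (g k))
  have hsphere (k : ℕ) : ‖P (g k)‖⁻¹ • P (g k) ∈ Metric.sphere (0 : E) 1 := by
    simp [norm_smul, hPg0 k]
  obtain ⟨u, hu, φ, hφ, hlim⟩ := (isCompact_sphere (0 : E) 1).tendsto_subseq hsphere
  have huL : u ∈ G.linealitySpace :=
    mem_linealitySpace_of_tendsto hG (fun k => hPgG (φ k))
      (hPg.comp hφ.tendsto_atTop) hlim
  have huW : u ∈ W := W.closed_of_finiteDimensional.mem_of_tendsto hlim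
    (Filter.Eventually.of_forall fun k => W.smul_mem _ (hPW _))
  have : u = 0 := Submodule.disjoint_def.1 hW.disjoint u huL huW
  simp [this] at hu

/-- Given a subspace `V` of the real span of a subgroup `Λ`, the closure of `V + Λ` contains a
subspace that is spanned by finitely many elements of `Λ` and contains `V`. -/
theorem exists_finset_span_subset_closure [FiniteDimensional ℝ E] (Λ : AddSubgroup E)
    (V : Submodule ℝ E) (hV : V ≤ Submodule.span ℝ (Λ : Set E)) :
    ∃ s : Finset Λ, V ≤ Submodule.span ℝ ((↑) '' (s : Set Λ) : Set E) ∧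
      (Submodule.span ℝ ((↑) '' (s : Set Λ) : Set E) : Set E) ⊆
        closure ((V.toAddSubgroup ⊔ Λ : AddSubgroup E) : Set E) := by
  set G : AddSubgroup E := (V.toAddSubgroup ⊔ Λ).topologicalClosure with hGdef
  have hle : V.toAddSubgroup ⊔ Λ ≤ G := AddSubgroup.le_topologicalClosure _
  have hG : IsClosed (G : Set E) := AddSubgroup.isClosed_topologicalClosure _
  obtain ⟨δ, hδ, hball⟩ := AddSubgroup.exists_ball_subset_linealitySpace hG
  have hVG (v : E) (hv : v ∈ V) : v ∈ G.linealitySpace := fun t =>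
    hle (AddSubgroup.mem_sup_left (V.smul_mem t hv))
  set S : Set E := (Λ : Set E) ∩ G.linealitySpace with hS
  have hVS : V ≤ Submodule.span ℝ S := by
    intro v hv
    have hcl : IsClosed (Submodule.span ℝ S : Set E) := Submodule.closed_of_finiteDimensional _
    rw [← SetLike.mem_coe, ← hcl.closure_eq, Metric.mem_closure_iff]
    intro ε hε
    -- The bound δ forces l into the lineality space; the bound ε, with m ≥ 1, makes l / m
    -- approximate v.
    obtain ⟨m, hm, l, hl, hlt⟩ := exists_nsmul_sub_norm_lt Λ (hV hv) (lt_min hε hδ)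
    have hm1 : (1 : ℝ) ≤ m := by exact_mod_cast hm
    have hmv : (m : ℝ) • v ∈ G.linealitySpace := G.linealitySpace.smul_mem _ (hVG v hv)
    have hdiff : (m : ℝ) • v - l ∈ G.linealitySpace :=
      hball _ (G.sub_mem (AddSubgroup.mem_of_mem_linealitySpace hmv)
        (hle (AddSubgroup.mem_sup_right hl))) (hlt.trans_le (min_le_right _ _))
    have hlS : l ∈ S := ⟨hl, by simpa using G.linealitySpace.sub_mem hmv hdiff⟩
    refine ⟨(m : ℝ)⁻¹ • l, Submodule.smul_mem _ _ (Submodule.subset_span hlS), ?_⟩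
    have heq : v - (m : ℝ)⁻¹ • l = (m : ℝ)⁻¹ • ((m : ℝ) • v - l) := by
      rw [smul_sub, smul_smul, inv_mul_cancel₀ (by positivity), one_smul]
    rw [dist_eq_norm, heq, norm_smul, norm_inv, Real.norm_natCast]
    exact (mul_le_of_le_one_left (norm_nonneg _) (inv_le_one_of_one_le₀ hm1)).trans_lt
      (hlt.trans_le (min_le_left _ _))
  obtain ⟨s, hsS, hspan⟩ := (Submodule.fg_span_iff_fg_span_finset_subset S).1
    (IsNoetherian.noetherian (Submodule.span ℝ S))
  have himage : ((↑) '' ((↑) ⁻¹' (s : Set E) : Set Λ) : Set E) = s := by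
    exact Set.image_preimage_eq_of_subset fun x hx => ⟨⟨x, (hsS hx).1⟩, rfl⟩
  have hfin : ((↑) ⁻¹' (s : Set E) : Set Λ).Finite :=
    s.finite_toSet.preimage Subtype.coe_injective.injOn
  refine ⟨hfin.toFinset, ?_, ?_⟩
  · rw [hfin.coe_toFinset, himage, ← hspan]
    exact hVS
  · rw [hfin.coe_toFinset, himage, ← hspan]
    have : Submodule.span ℝ S ≤ G.linealitySpace := Submodule.span_le.2 Set.inter_subset_right
    exact fun x hx => AddSubgroup.mem_of_mem_linealitySpace (this hx)

end ClosedSubgroups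

/-! ### Baire category on a neat family -/

/-- An embedded `C¹` submanifold is locally closed. -/
theorem IsC1Submanifold.isLocallyClosed {E : Type*} [NormedAddCommGroup E] [NormedSpace ℝ E]
    [FiniteDimensional ℝ E] {M : Set E} (hM : IsC1Submanifold M) : IsLocallyClosed M := by
  refine ((isLocallyClosed_tfae M).out 0 2).2 fun x hx => ?_
  obtain ⟨Φ, V, hxΦ, -, -, hΦ⟩ := hM x hx
  refine ⟨Φ.source, Φ.open_source.mem_nhds hxΦ, ?_⟩
  have heq : (Subtype.val ⁻¹' M : Set Φ.source) = Φ.source.domRestrict Φ ⁻¹' (V : Set E) := by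
    ext ⟨y, hy⟩
    refine ⟨fun hyM => (hΦ.subset ⟨y, ⟨hyM, hy⟩, rfl⟩).1, fun hyV => ?_⟩
    obtain ⟨z, ⟨hzM, hz⟩, hzy⟩ := hΦ.superset ⟨hyV, Φ.map_source hy⟩
    exact Φ.injOn hz hy hzy ▸ hzM
  rw [heq]
  exact V.closed_of_finiteDimensional.preimage Φ.continuousOn.domRestrict

namespace GrAff

variable {F : Type*} [RCLike F] {n j : ℕ}

theorem foot_mem (A : GrAff F n j) : A.foot ∈ A.flat :=
  haveI : Nonempty A.flat := A.nonempty.to_subtype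
  EuclideanGeometry.orthogonalProjection_mem _

theorem foot_add_mem (A : GrAff F n j) {v : EuclideanSpace F (Fin n)} (hv : v ∈ A.lin) :
    A.foot + v ∈ A.flat := by
  rw [add_comm]
  exact AffineSubspace.vadd_mem_of_mem_direction hv A.foot_mem

theorem sub_foot_mem (A : GrAff F n j) {a : EuclideanSpace F (Fin n)} (ha : a ∈ A.flat) :
    a - A.foot ∈ A.lin :=
  AffineSubspace.vsub_mem_direction ha A.foot_mem

/-- Expresses the inclusion through the projection coordinate of `embed`, one vector w at a time, so
that for closed S its failure is an open condition. -/
theorem lin_subset_iff (A : GrAff F n j) {S : Set (EuclideanSpace F (Fin n))} :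
    (A.lin : Set (EuclideanSpace F (Fin n))) ⊆ S ↔ ∀ w, A.embed.1 w ∈ S := by
  refine ⟨fun h w => h (Submodule.starProjection_apply_mem _ _), fun h w hw => ?_⟩
  have := h w
  rwa [embed, Submodule.starProjection_eq_self_iff.2 hw] at this

/-- H need only be a real subspace: the sum of the L(A) is the same over ℝ as over F, because each
L(A) is already F-linear. -/
theorem linSpan_le_of_forall {T : Set (GrAff F n j)}
    {H : Submodule ℝ (EuclideanSpace F (Fin n))}
    (h : ∀ A ∈ T, (A.lin : Set (EuclideanSpace F (Fin n))) ⊆ H) :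
    (linSpan T : Set (EuclideanSpace F (Fin n))) ⊆ H := by
  have : (linSpan T).restrictScalars ℝ ≤ H := by
    simp only [linSpan, Submodule.restrictScalars_iSup]
    exact iSup₂_le h
  exact this

/-- In a neat family, the flats whose linear part avoids each of countably many subspaces not
containing `L(T)` are dense. -/
theorem exists_mem_nhds_not_lin_subset {T : Set (GrAff F n j)}
    (hM : IsC1Submanifold (embed '' T))
    (hT : ∀ U : Set (GrAff F n j), IsOpen U → (T ∩ U).Nonempty → linSpan (T ∩ U) = linSpan T)
    {ι : Type*} [Countable ι] (H : ι → Submodule ℝ (EuclideanSpace F (Fin n)))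
    (hH : ∀ i, ¬ (linSpan T : Set (EuclideanSpace F (Fin n))) ⊆ H i)
    {U : Set ((EuclideanSpace F (Fin n) →L[F] EuclideanSpace F (Fin n)) ×
      EuclideanSpace F (Fin n))} (hU : IsOpen U) {A : GrAff F n j} (hA : A ∈ T)
    (hAU : A.embed ∈ U) :
    ∃ B ∈ T, B.embed ∈ U ∧ ∀ i, ¬ (B.lin : Set (EuclideanSpace F (Fin n))) ⊆ H i := by
  have : FiniteDimensional ℝ ((EuclideanSpace F (Fin n) →L[F] EuclideanSpace F (Fin n)) ×
      EuclideanSpace F (Fin n)) := FiniteDimensional.trans ℝ F _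
  have : ProperSpace ((EuclideanSpace F (Fin n) →L[F] EuclideanSpace F (Fin n)) ×
      EuclideanSpace F (Fin n)) := FiniteDimensional.proper_real _
  have : LocallyCompactSpace (embed '' T) := hM.isLocallyClosed.locallyCompactSpace
  let O : ι → Set (embed '' T) := fun i => {p | ∃ w, p.1.1 w ∉ H i}
  have hopen (i : ι) : IsOpen (O i) := by
    simp only [O, Set.ofPred_exists]
    refine isOpen_iUnion fun w => ?_
    refine (H i).closed_of_finiteDimensional.isOpen_compl.preimage
      (f := fun p : embed '' T => p.1.1 w) ?_
    exact (ContinuousLinearMap.apply F _ w).continuous.comp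
      (continuous_fst.comp continuous_subtype_val)
  have hdense (i : ι) : Dense (O i) := by
    rw [dense_iff_inter_open]
    rintro _ ⟨W, hW, rfl⟩ ⟨⟨_, B, hB, rfl⟩, hBW⟩
    -- If `O i` missed W, every flat of T in W would have its linear part in `H i`, and neatness
    -- would put L(T) in `H i`.
    by_contra hne
    refine hH i ?_
    rw [← hT (embed ⁻¹' W) (hW.preimage continuous_induced_dom) ⟨B, hB, hBW⟩]
    refine linSpan_le_of_forall fun C hC => C.lin_subset_iff.2 fun w => ?_
    by_contra hw
    exact hne ⟨⟨C.embed, C, hC.1, rfl⟩, hC.2, w, hw⟩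
  obtain ⟨⟨_, B, hB, rfl⟩, hBU, hBO⟩ := (dense_iInter_of_isOpen hopen hdense).inter_open_nonempty
    _ (hU.preimage continuous_subtype_val) ⟨⟨A.embed, A, hA, rfl⟩, hAU⟩
  refine ⟨B, hB, hBU, fun i hi => ?_⟩
  obtain ⟨w, hw⟩ := Set.mem_iInter.1 hBO i
  exact hw (B.lin_subset_iff.1 hi w)

theorem isDenseSubset_image_mk {T : Set (GrAff F n j)}
    (hM : IsC1Submanifold (embed '' T))
    (hT : ∀ U : Set (GrAff F n j), IsOpen U → (T ∩ U).Nonempty → linSpan (T ∩ U) = linSpan T)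
    (Λ : AddSubgroup (EuclideanSpace F (Fin n))) [DiscreteTopology Λ]
    (hΛ : ∀ A ∈ T, (A.lin : Set (EuclideanSpace F (Fin n))) ⊆
      Submodule.span ℝ (Λ : Set (EuclideanSpace F (Fin n)))) :
    IsDenseSubset
      (⋃ A ∈ T, (QuotientAddGroup.mk : EuclideanSpace F (Fin n) →
        EuclideanSpace F (Fin n) ⧸ Λ) '' (A.flat : Set (EuclideanSpace F (Fin n))))
      (⋃ A ∈ T, (QuotientAddGroup.mk : EuclideanSpace F (Fin n) →
        EuclideanSpace F (Fin n) ⧸ Λ) '' ((A.flat : Set (EuclideanSpace F (Fin n))) +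
          (GrAff.linSpan T : Set (EuclideanSpace F (Fin n))))) := by
  have : FiniteDimensional ℝ (EuclideanSpace F (Fin n)) := FiniteDimensional.trans ℝ F _
  have : ProperSpace (EuclideanSpace F (Fin n)) := FiniteDimensional.proper_real _
  have : Countable Λ := TopologicalSpace.separableSpace_iff_countable.1 inferInstance
  refine ⟨Set.iUnion₂_mono fun A _ => Set.image_mono fun x hx =>
    ⟨x, hx, 0, (linSpan T).zero_mem, add_zero x⟩, Set.iUnion₂_subset fun A hA => ?_⟩
  rintro _ ⟨_, ⟨a, ha, l, hl, rfl⟩, rfl⟩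
  let E := EuclideanSpace F (Fin n)
  let span (s : Finset Λ) : Submodule ℝ E := Submodule.span ℝ ((↑) '' (s : Set Λ) : Set E)
  rw [mem_closure_iff]
  intro O hO haO
  -- Carries the point a + l of A + L(T) continuously to nearby flats: at `B.embed` it is a point of
  -- B, plus l, and at `A.embed` it is a + l.
  let f : (E →L[F] E) × E → E ⧸ Λ := fun p => (p.2 + p.1 (a - A.foot) + l : E)
  have hf : Continuous f := by
    refine QuotientAddGroup.continuous_mk.comp ((continuous_snd.add ?_).add continuous_const)
    exact (ContinuousLinearMap.apply F _ (a - A.foot)).continuous.comp continuous_fst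
  have hAO : A.embed ∈ f ⁻¹' O := by
    have : A.lin.starProjection (a - A.foot) = a - A.foot :=
      Submodule.starProjection_eq_self_iff.2 (A.sub_foot_mem ha)
    simpa only [f, embed, Set.mem_preimage, this, add_sub_cancel] using haO
  obtain ⟨B, hB, hBO, hBH⟩ := exists_mem_nhds_not_lin_subset hM hT
    (fun s : {s : Finset Λ // ¬ (linSpan T : Set E) ⊆ span s} => span s) (fun s => s.2)
    (hO.preimage hf) hA hAO
  obtain ⟨s, hs, hscl⟩ := exists_finset_span_subset_closure Λ (B.lin.restrictScalars ℝ) (hΛ B hB)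
  have hlcl : l ∈
      closure (((B.lin.restrictScalars ℝ).toAddSubgroup ⊔ Λ : AddSubgroup E) : Set E) := by
    by_contra hne
    exact hBH ⟨s, fun h => hne (hscl (h hl))⟩ hs
  let g : E → E ⧸ Λ := fun y => (B.foot + B.lin.starProjection (a - A.foot) + y : E)
  have hg : Continuous g := QuotientAddGroup.continuous_mk.comp (continuous_const.add continuous_id)
  obtain ⟨y, hyO, hy⟩ := mem_closure_iff.1 hlcl (g ⁻¹' O) (hO.preimage hg) hBO
  -- Replacing l by v + z with v ∈ L(B) and z ∈ Λ gives a point of B up to z, which vanishes in the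
  -- quotient.
  obtain ⟨v, hv, z, hz, rfl⟩ := AddSubgroup.mem_sup.1 hy
  refine ⟨_, hyO, Set.mem_iUnion₂.2 ⟨B, hB, B.foot + (B.lin.starProjection (a - A.foot) + v),
    B.foot_add_mem (B.lin.add_mem (Submodule.starProjection_apply_mem _ _) hv), ?_⟩⟩
  rw [QuotientAddGroup.eq]
  have : -(B.foot + (B.lin.starProjection (a - A.foot) + v)) +
      (B.foot + B.lin.starProjection (a - A.foot) + (v + z)) = z := by abel
  rwa [this]

end GrAff

theorem mainTheorem5 :
    -- the real, o-minimal setting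
    (∀ (Lom : FirstOrder.Language.{u, v}) [Lom.Structure ℝ], IsOMinimalExpansion Lom →
      ∀ (n j : ℕ) (L : Submodule ℝ (EuclideanSpace ℝ (Fin n)))
        (Λ : AddSubgroup (EuclideanSpace ℝ (Fin n))),
        DiscreteTopology Λ →
        Submodule.span ℝ (Λ : Set (EuclideanSpace ℝ (Fin n))) = L →
        ∀ T : Set (GrAff ℝ n j), GrAff.IsNeat Lom T → (∀ A ∈ T, A.lin ≤ L) →
          IsDenseSubset
            (⋃ A ∈ T, (QuotientAddGroup.mk : EuclideanSpace ℝ (Fin n) →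
              EuclideanSpace ℝ (Fin n) ⧸ Λ) '' (A.flat : Set (EuclideanSpace ℝ (Fin n))))
            (⋃ A ∈ T, (QuotientAddGroup.mk : EuclideanSpace ℝ (Fin n) →
              EuclideanSpace ℝ (Fin n) ⧸ Λ) '' ((A.flat : Set (EuclideanSpace ℝ (Fin n))) +
                (GrAff.linSpan T : Set (EuclideanSpace ℝ (Fin n)))))) ∧
    -- the complex, algebraic setting
    (∀ (n j : ℕ) (L : Submodule ℂ (EuclideanSpace ℂ (Fin n)))
        (Λ : AddSubgroup (EuclideanSpace ℂ (Fin n))),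
        DiscreteTopology Λ →
        Submodule.span ℝ (Λ : Set (EuclideanSpace ℂ (Fin n))) = L.restrictScalars ℝ →
        ∀ T : Set (GrAff ℂ n j), GrAff.IsNeat FirstOrder.Language.ring T →
          (∀ A ∈ T, A.lin ≤ L) →
          IsDenseSubset
            (⋃ A ∈ T, (QuotientAddGroup.mk : EuclideanSpace ℂ (Fin n) →
              EuclideanSpace ℂ (Fin n) ⧸ Λ) '' (A.flat : Set (EuclideanSpace ℂ (Fin n))))
            (⋃ A ∈ T, (QuotientAddGroup.mk : EuclideanSpace ℂ (Fin n) →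
              EuclideanSpace ℂ (Fin n) ⧸ Λ) '' ((A.flat : Set (EuclideanSpace ℂ (Fin n))) +
                (GrAff.linSpan T : Set (EuclideanSpace ℂ (Fin n)))))) := by
  refine ⟨fun Lom _ _ n j L Λ _ hL T hT hTL => ?_, fun n j L Λ _ hL T hT hTL => ?_⟩
  · exact GrAff.isDenseSubset_image_mk hT.submanifold hT.linSpan_eq Λ fun A hA => hL ▸ hTL A hA
  · exact GrAff.isDenseSubset_image_mk hT.submanifold hT.linSpan_eq Λ fun A hA => hL ▸ hTL A hA
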